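/- **Theorem 5.1.** Let $E$ and $A$ be Borel spaces (Borel subsets of Polish spaces), $\mathcal Z$ a measurable space, and let $Z_1,Z_2,\dots$ be i.i.d. $\mathcal Z$-valued random elements on a probability space $(\Omega,\mathcal A,\mathbb P)$; $Z$ denotes a random element with their common law. Let $D\subseteq E\times A$ be measurable and contain the graph of a measurable mapping $E\to A$, put $D(x)=\{a\in A:(x,a)\in D\}$, let $T:D\times\mathcal Z\to E$ be measurable, $c:D\times E\to\mathbb R_+$, and $\beta>0$. Assume that (i) every $D(x)$ is compact, and whenever $x_k\to x$ and $a_k\in D(x_k)$ for all $k$, the sequence $(a_k)$ has an accumulation point in $D(x)$; (ii) $T(\cdot,\cdot,z)$ is continuous on $D$ for every $z\in\mathcal Z$; (iii) $c$ is lower semicontinuous. Let $g:\mathbb R\to\mathbb R$ be increasing and convex with $g\ge 0$ on $[0,\infty)$, and put $g(\infty)=\lim_{r\to\infty}g(r)$. All value functions below may take the value $+\infty$. Let $\widehat E=E\times\mathbb R_+\times(0,\infty)$. A Markov decision rule is a measurable $d:\widehat E\to A$ with $d(x,s,t)\in D(x)$ for all $(x,s,t)$; a Markov policy is a sequence $\pi=(d_0,d_1,\dots)$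 of such rules. Under $\pi$ and the initial state $(X_0,\mathbf s_0,\mathbf t_0)=(x,s,t)\in\widehat E$ the extended decision process is given, with $a_k=d_k(X_k,\mathbf s_k,\mathbf t_k)$, by $$X_{k+1}=T(X_k,a_k,Z_{k+1}),\qquad \mathbf s_{k+1}=\mathbf s_k+\mathbf t_k\,c(X_k,a_k,X_{k+1}),\qquad \mathbf t_{k+1}=\beta\,\mathbf t_k .$$ For $N\in\mathbb N_0\cup\{\infty\}$ define $$J_{N\pi}(x,s,t)=\mathbb E\Big[g\Big(s+t\sum_{0\le k<N}\beta^k c(X_k,a_k,X_{k+1})\Big)\Big],\qquad J_N(x,s,t)=\inf_\pi J_{N\pi}(x,s,t),$$ the infimum being over all Markov policies. Let $\mathbb M$ be the set of all lower semicontinuous $v:\widehat E\to[0,\infty]$ such that $v(x,\cdot,\cdot)$ is increasing for every $x\in E$ and $v(x,s,t)\ge g(s)$ on $\widehat E$. For $v\in\mathbb M$ and a Markov decision rule $d$ let $$Lv(x,s,t,a)=\mathbb E\big[v\big(T(x,a,Z),\,s+t\,c(x,a,T(x,a,Z)),\,\beta t\big)\big],\qquad a\in D(x),$$ $$\mathcal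 T_d v(x,s,t)=Lv(x,s,t,d(x,s,t)),\qquad \mathcal T v(x,s,t)=\inf_{a\in D(x)}Lv(x,s,t,a).$$ Then: a) $J_\infty(x,s,t)=\lim_{N\to\infty}J_N(x,s,t)$ for all $(x,s,t)\in\widehat E$, and $J_\infty$ is the smallest fixed point of $\mathcal T$ in $\mathbb M$, i.e. $J_\infty\in\mathbb M$, $\mathcal T J_\infty=J_\infty$, and $J_\infty\le v$ for every $v\in\mathbb M$ with $\mathcal T v=v$. b) There is a Markov decision rule $d^*$ with $\mathcal T_{d^*}J_\infty=\mathcal T J_\infty$, and for every such $d^*$ the stationary policy $\pi^*=(d^*,d^*,\dots)$ is optimal: $J_{\infty\pi^*}=J_\infty$ on $\widehat E$. -/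

import Mathlib

open MeasureTheory ProbabilityTheory Filter Topology
open scoped NNReal ENNReal

noncomputable section

namespace SpectralMDP

/-- The interval `(0, ∞)`, in which the discounting variable `t` lives. -/
abbrev PosReal : Type := Set.Ioi (0 : ℝ≥0)

/-- The extended state space `E × ℝ₊ × (0, ∞)`; its elements are the triples `(x, s, t)`. -/
abbrev ExtState (E : Type*) : Type _ := E × ℝ≥0 × PosReal

/-- The data of a stationary Markov decision model without terminal cost: admissible
state-action pairs, transition function, one-stage cost function and discount factor. -/
structure Model (E A S : Type*) [MeasurableSpace E] [MeasurableSpace A] [MeasurableSpace S] where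
  /-- the admissible state-action pairs -/
  D : Set (E × A)
  measurableSet_D : MeasurableSet D
  /-- `D` contains the graph of a measurable mapping -/
  exists_selector : ∃ f : E → A, Measurable f ∧ ∀ x, (x, f x) ∈ D
  /-- the transition function -/
  T : D × S → E
  measurable_T : Measurable T
  /-- the one-stage cost `c(x, a, x')` -/
  c : D × E → ℝ≥0
  /-- the discount factor -/
  β : ℝ≥0
  β_pos : 0 < β

/-- An increasing convex function `ℝ → ℝ`, non-negative on `[0, ∞)`. -/
structure IsDisutility (g : ℝ → ℝ) : Prop where
  mono : Monotone g
  convex : ConvexOn ℝ Set.univ g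
  nonneg : ∀ y, 0 ≤ y → 0 ≤ g y

/-- The extension of an increasing `g` to `[0, ∞]` by `g(∞) = lim_{r → ∞} g(r)`. -/
def gExt (g : ℝ → ℝ) (y : ℝ≥0∞) : ℝ≥0∞ :=
  if y = ∞ then ⨆ r : ℝ≥0, ENNReal.ofReal (g r) else ENNReal.ofReal (g y.toReal)

namespace Model

section Basic

variable {E A S : Type*} [MeasurableSpace E] [MeasurableSpace A] [MeasurableSpace S]

/-- The set `D(x)` of admissible actions in state `x`. -/
def adm (M : Model E A S) (x : E) : Set A := {a | (x, a) ∈ M.D}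

/-- The continuity and compactness assumption on the model data. -/
structure ContinuousCompact [TopologicalSpace E] [TopologicalSpace A] (M : Model E A S) :
    Prop where
  isCompact_adm : ∀ x, IsCompact (M.adm x)
  /-- upper semicontinuity of `x ↦ D(x)` -/
  usc_adm : ∀ (xs : ℕ → E) (x : E) (as : ℕ → A), Tendsto xs atTop (𝓝 x) →
    (∀ k, as k ∈ M.adm (xs k)) → ∃ a ∈ M.adm x, MapClusterPt a atTop as
  continuous_T : ∀ z : S, Continuous fun p : M.D => M.T (p, z)
  lsc_c : LowerSemicontinuous M.c

/-- The transition function of the extended model: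
`(x, s, t), a, z ↦ (T(x,a,z), s + t c(x,a,T(x,a,z)), β t)`. -/
def extT (M : Model E A S) (e : ExtState E) (a : M.adm e.1) (z : S) : ExtState E :=
  let p : M.D := ⟨(e.1, a.1), a.2⟩
  let x' : E := M.T (p, z)
  (x', e.2.1 + e.2.2.1 * M.c (p, x'), ⟨M.β * e.2.2.1, mul_pos M.β_pos e.2.2.2⟩)

/-- A Markov decision rule of the extended model. -/
structure Rule (M : Model E A S) where
  toFun : ExtState E → A
  measurable_toFun : Measurable toFun
  mem_adm : ∀ e, toFun e ∈ M.adm e.1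

/-- The admissible action chosen by a decision rule in an extended state. -/
def Rule.act {M : Model E A S} (d : M.Rule) (e : ExtState E) : M.adm e.1 := ⟨d.toFun e, d.mem_adm e⟩

/-- A Markov policy `(d₀, d₁, …)` of the extended model. -/
abbrev Policy (M : Model E A S) : Type _ := ℕ → M.Rule

/-- `L v(x,s,t,a) = E[v(T̂(x,s,t,a,Z))]`, where `Z` has law `ν`. -/
def L (M : Model E A S) (ν : Measure S) (v : ExtState E → ℝ≥0∞) (e : ExtState E)
    (a : M.adm e.1) : ℝ≥0∞ :=
  ∫⁻ z, v (M.extT e a z) ∂ν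

/-- The operator `𝒯_d` of a Markov decision rule `d`. -/
def ruleOp (M : Model E A S) (ν : Measure S) (d : M.Rule) (v : ExtState E → ℝ≥0∞) :
    ExtState E → ℝ≥0∞ :=
  fun e => M.L ν v e (d.act e)

/-- The Bellman operator `𝒯`. -/
def bellman (M : Model E A S) (ν : Measure S) (v : ExtState E → ℝ≥0∞) : ExtState E → ℝ≥0∞ :=
  fun e => ⨅ a : M.adm e.1, M.L ν v e a

section Dynamics

variable {Ω : Type*} [MeasurableSpace Ω]

/-- The extended decision process `(X_n, s_n, t_n)` under a Markov policy started in `e`;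
`Z n` is the disturbance that drives the transition from time `n` to time `n + 1`. -/
def process (M : Model E A S) (Z : ℕ → Ω → S) (π : M.Policy) (e : ExtState E) (ω : Ω) :
    ℕ → ExtState E
  | 0 => e
  | n + 1 =>
    let en := process M Z π e ω n
    M.extT en ((π n).act en) (Z n ω)

/-- The undiscounted cost `c(X_k, d_k(X_k, s_k, t_k), X_{k+1})` of stage `k`. -/
def stageCost (M : Model E A S) (Z : ℕ → Ω → S) (π : M.Policy) (e : ExtState E) (k : ℕ)
    (ω : Ω) : ℝ≥0 :=
  let ek := M.process Z π e ω k
  M.c (⟨(ek.1, (π k).toFun ek), (π k).mem_adm ek⟩, (M.process Z π e ω (k + 1)).1)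

/-- The value `J_{Nπ}(x,s,t) = E[g(s + t ∑_{k<N} β^k c(X_k, d_k, X_{k+1}))]`. -/
def policyValue (M : Model E A S) (P : Measure Ω) (Z : ℕ → Ω → S) (g : ℝ → ℝ) (N : ℕ)
    (π : M.Policy) (e : ExtState E) : ℝ≥0∞ :=
  ∫⁻ ω, ENNReal.ofReal
    (g ((e.2.1 + e.2.2.1 * ∑ k ∈ Finset.range N, M.β ^ k * M.stageCost Z π e k ω : ℝ≥0) : ℝ)) ∂P

/-- The finite-horizon value function `J_N`, the infimum over all Markov policies. -/
def value (M : Model E A S) (P : Measure Ω) (Z : ℕ → Ω → S) (g : ℝ → ℝ) (N : ℕ)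
    (e : ExtState E) : ℝ≥0∞ :=
  ⨅ π : M.Policy, M.policyValue P Z g N π e

/-- The value `J_{∞π}(x,s,t) = E[g(s + t ∑_{k<∞} β^k c(X_k, d_k, X_{k+1}))]`; the total cost may
be infinite. -/
def policyValueInf (M : Model E A S) (P : Measure Ω) (Z : ℕ → Ω → S) (g : ℝ → ℝ)
    (π : M.Policy) (e : ExtState E) : ℝ≥0∞ :=
  ∫⁻ ω, gExt g
    ((e.2.1 : ℝ≥0∞) + ((e.2.2.1 : ℝ≥0) : ℝ≥0∞) *
      ∑' k : ℕ, ((M.β ^ k * M.stageCost Z π e k ω : ℝ≥0) : ℝ≥0∞)) ∂P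

/-- The infinite-horizon value function `J_∞`, the infimum over all Markov policies. -/
def valueInf (M : Model E A S) (P : Measure Ω) (Z : ℕ → Ω → S) (g : ℝ → ℝ)
    (e : ExtState E) : ℝ≥0∞ :=
  ⨅ π : M.Policy, M.policyValueInf P Z g π e

end Dynamics

end Basic

end Model

/-- The set `𝕄` of potential value functions. The value `+∞` is allowed, since the value
functions may be infinite. -/
def potentialValues (E : Type*) [TopologicalSpace E] (g : ℝ → ℝ) : Set (ExtState E → ℝ≥0∞) :=
  {v | LowerSemicontinuous v ∧
    (∀ x : E, Monotone fun st : ℝ≥0 × PosReal => v (x, st)) ∧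
    ∀ e : ExtState E, ENNReal.ofReal (g (e.2.1 : ℝ)) ≤ v e}

end SpectralMDP

end

/-!
Write `V_N = 𝒯^N V_0` with `V_0(x, s, t) = g(s)`. With `X_k` the
extended state at time `k`, the cost of `N` stages of play is `E[g(s_N)] = E[V_0(X_N)]`. Since `X_k`
is a function of the first `k` disturbances, it is independent of the next one, and hence
`E[v(X_{k+1})] = E[(𝒯_{d_k} v)(X_k)]` (`ContinuousCompact.lintegral_process_succ`), and
every comparison between a policy and the Bellman operator follows from this identity by induction over the stages.

The analytic input is that `𝒯` maps `𝕄` into itself and that its infimum is attained by a measurable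
rule. `L v` is jointly lower semicontinuous (`ContinuousCompact.lowerSemicontinuous_costToGo`): the
accumulated cost is only lower semicontinuous, which is harmless since `v` increases in it. The
condition on `x ↦ D(x)` says that projections of closed sets of admissible pairs are closed
(`ContinuousCompact.isClosed_projection`), so `𝒯 v` is again lower semicontinuous and the minimizers
form a measurable compact-valued map, from which a measurable rule is selected
(`IsCompactCorrespondence.exists_measurable_selector`).

So `J_N = V_N` (`ContinuousCompact.value_eq_valueIter`). The sequence increases to some `V ∈ 𝕄`, and
`𝒯 V = V` because compactness lets the infimum over actions commute with increasing limits
(`ContinuousCompact.bellman_iSup`). By monotone convergence `J_{∞π} = sup_N J_{Nπ} ≥ V` for every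
policy. Conversely, if `d` satisfies `𝒯_d V = V`, then `V(x, s, t) = E[V(X_N)] ≥ E[g(s_N)]` for all
`N` under the stationary policy `(d, d, …)`, whose cost is therefore at most `V`
(`ContinuousCompact.policyValueInf_stationary_le`). Thus `V = J_∞` and all such `d` are optimal.
Any fixed point in `𝕄` dominates `V_0`, hence all `V_N`, hence `V`.
-/

namespace SpectralMDP

/-! ### Measurable selection of minimizers -/

section Selection

variable {X A : Type*} [MeasurableSpace X] [TopologicalSpace A]

/-- A set-valued map with nonempty compact values that is measurable in the sense that the set of
points whose value hits a given closed set is measurable. -/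
structure IsCompactCorrespondence (F : X → Set A) : Prop where
  nonempty : ∀ x, (F x).Nonempty
  isCompact : ∀ x, IsCompact (F x)
  measurableSet_hit : ∀ C, IsClosed C → MeasurableSet {x | (F x ∩ C).Nonempty}

/-- The minimizers of `u x` over `F x`. -/
def argmin (F : X → Set A) (u : X → A → ℝ≥0∞) (x : X) : Set A :=
  {a ∈ F x | ∀ b ∈ F x, u x a ≤ u x b}

/-- Minimizing a lower semicontinuous function preserves compact values and measurability, when
the set where some point of `F x ∩ C` lies below a given level is measurable. -/
theorem IsCompactCorrespondence.argmin [T2Space A] {F : X → Set A} {u : X → A → ℝ≥0∞}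
    (hF : IsCompactCorrespondence F) (hu : ∀ x, LowerSemicontinuous (u x))
    (hm : ∀ C, IsClosed C → ∀ q, MeasurableSet {x | ∃ a ∈ F x ∩ C, u x a ≤ q}) :
    IsCompactCorrespondence (argmin F u) where
  nonempty x := by
    obtain ⟨a, ha, hmin⟩ :=
      ((hu x).lowerSemicontinuousOn (F x)).exists_isMinOn (hF.nonempty x) (hF.isCompact x)
    exact ⟨a, ha, fun b hb => hmin hb⟩
  isCompact x := by
    have h : SpectralMDP.argmin F u x = F x ∩ ⋂ b ∈ F x, u x ⁻¹' Set.Iic (u x b) := by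
      ext a
      simp [SpectralMDP.argmin]
    rw [h]
    exact (hF.isCompact x).inter_right (isClosed_biInter fun b _ => (hu x).isClosed_preimage _)
  measurableSet_hit C hC := by
    -- The minimum over `F x ∩ C` is at most the minimum over `F x`, tested on rational levels.
    have h : {x | (SpectralMDP.argmin F u x ∩ C).Nonempty} =
        {x | (F x ∩ C).Nonempty} ∩ ⋂ q : ℚ, ({x | ∃ a ∈ F x ∩ Set.univ, u x a ≤ ENNReal.ofReal q}ᶜ
          ∪ {x | ∃ a ∈ F x ∩ C, u x a ≤ ENNReal.ofReal q}) := by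
      ext x
      simp only [Set.mem_ofPred_eq, Set.mem_inter_iff, Set.mem_iInter, Set.mem_union,
        Set.mem_compl_iff]
      constructor
      · rintro ⟨a, ⟨haF, hmin⟩, haC⟩
        refine ⟨⟨a, haF, haC⟩, fun q => ?_⟩
        by_cases hq : ∃ b, (b ∈ F x ∧ b ∈ Set.univ) ∧ u x b ≤ ENNReal.ofReal q
        · obtain ⟨b, hb, hbq⟩ := hq
          exact Or.inr ⟨a, ⟨haF, haC⟩, (hmin b hb.1).trans hbq⟩
        · exact Or.inl hq
      · rintro ⟨hne, h⟩
        obtain ⟨a, ha, hmin⟩ := ((hu x).lowerSemicontinuousOn (F x ∩ C)).exists_isMinOn hne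
          ((hF.isCompact x).inter_right hC)
        refine ⟨a, ⟨ha.1, fun b hb => ?_⟩, ha.2⟩
        by_contra! hlt
        obtain ⟨q, _, hbq, hqa⟩ := ENNReal.lt_iff_exists_rat_btwn.1 hlt
        rcases h q with h | ⟨a', ha', ha'q⟩
        · exact h ⟨b, ⟨hb, trivial⟩, hbq.le⟩
        · exact absurd ((hmin ha').trans ha'q) (not_le.2 hqa)
    rw [h]
    exact (hF.measurableSet_hit C hC).inter (MeasurableSet.iInter fun q =>
      (hm _ isClosed_univ _).compl.union (hm C hC _))

/-- A Kuratowski–Ryll-Nardzewski theorem for compact values. The selected point minimizes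
successively the distances to the points of a dense sequence; the values of these distances, and
hence the point, are then measurable. -/
theorem IsCompactCorrespondence.exists_measurable_selector [TopologicalSpace.MetrizableSpace A]
    [SecondCountableTopology A] [MeasurableSpace A] [BorelSpace A] [StandardBorelSpace A]
    {F : X → Set A} (hF : IsCompactCorrespondence F) :
    ∃ f : X → A, Measurable f ∧ ∀ x, f x ∈ F x := by
  rcases isEmpty_or_nonempty X with hX | ⟨⟨x₀⟩⟩
  · exact ⟨isEmptyElim, measurable_of_empty _, isEmptyElim⟩
  have : Nonempty A := ⟨(hF.nonempty x₀).some⟩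
  let _ := TopologicalSpace.metrizableSpaceMetric A
  let q := TopologicalSpace.denseSeq A
  let G : ℕ → X → Set A := fun n =>
    Nat.rec F (fun n G => SpectralMDP.argmin G fun _ a => edist a (q n)) n
  have hcont : ∀ n, Continuous fun a => edist a (q n) := fun n => by fun_prop
  have hG : ∀ n, IsCompactCorrespondence (G n) := by
    intro n
    induction n with
    | zero => exact hF
    | succ n ih =>
      refine ih.argmin (fun _ => (hcont n).lowerSemicontinuous) fun C hC r => ?_
      convert ih.measurableSet_hit (C ∩ {a | edist a (q n) ≤ r})
        (hC.inter (isClosed_le (hcont n) continuous_const)) using 3 with x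
      simp only [Set.Nonempty, Set.mem_inter_iff, Set.mem_ofPred_eq, and_assoc]
  have hne : ∀ x, (⋂ n, G n x).Nonempty := fun x =>
    IsCompact.nonempty_iInter_of_sequence_nonempty_isCompact_isClosed (fun n => G n x)
      (fun n a ha => ha.1) (fun n => (hG n).nonempty x) ((hG 0).isCompact x)
      (fun n => ((hG n).isCompact x).isClosed)
  choose f hf using hne
  have hfG : ∀ n x, f x ∈ G n x := fun n x => Set.mem_iInter.1 (hf x) n
  refine ⟨f, ?_, hfG 0⟩
  have hdist : ∀ n, Measurable fun x => edist (f x) (q n) := by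
    refine fun n => measurable_of_Iic fun r => ?_
    convert (hG n).measurableSet_hit {a | edist a (q n) ≤ r}
      (isClosed_le (hcont n) continuous_const) using 1
    ext x
    exact ⟨fun h => ⟨f x, hfG n x, h⟩, fun ⟨a, ha, har⟩ => ((hfG (n + 1) x).2 a ha).trans har⟩
  have hemb : MeasurableEmbedding fun (a : A) (n : ℕ) => edist a (q n) := by
    refine Measurable.measurableEmbedding
      (measurable_pi_lambda _ fun n => (hcont n).measurable) fun a b hab => ?_
    by_contra hne
    have hpos : 0 < edist a b / 2 := ENNReal.half_pos (edist_pos.2 hne).ne'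
    obtain ⟨n, hn⟩ := (TopologicalSpace.denseRange_denseSeq A).exists_mem_open
      Metric.isOpen_eball ⟨a, Metric.mem_eball_self hpos⟩
    have h1 : edist a (q n) < edist a b / 2 := by
      rw [edist_comm]; exact hn
    have h2 : edist b (q n) < edist a b / 2 := (congrFun hab n).symm.trans_lt h1
    have h3 := (edist_triangle_right a b (q n)).trans_lt (ENNReal.add_lt_add h1 h2)
    rw [ENNReal.add_halves] at h3
    exact h3.false
  exact hemb.measurable_comp_iff.1 (measurable_pi_lambda _ hdist)

end Selection

namespace Model

/-! ### The Bellman operator on potential value functions -/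

section Basic

variable {E A S : Type*} [MeasurableSpace E] [MeasurableSpace A] [MeasurableSpace S]
  {M : Model E A S} {ν : Measure S} {v w : ExtState E → ℝ≥0∞}

open scoped Classical in
/-- The function `L v` as a function of state and action, with value `∞` at inadmissible pairs. -/
noncomputable def costToGo (M : Model E A S) (ν : Measure S) (v : ExtState E → ℝ≥0∞)
    (e : ExtState E) (a : A) : ℝ≥0∞ :=
  if h : a ∈ M.adm e.1 then M.L ν v e ⟨a, h⟩ else ∞

theorem costToGo_coe (e : ExtState E) (a : M.adm e.1) : M.costToGo ν v e a = M.L ν v e a := by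
  simp [costToGo]

theorem L_mono (h : v ≤ w) (e : ExtState E) (a : M.adm e.1) : M.L ν v e a ≤ M.L ν w e a :=
  lintegral_mono fun _ => h _

theorem costToGo_mono (h : v ≤ w) (e : ExtState E) (a : A) :
    M.costToGo ν v e a ≤ M.costToGo ν w e a := by
  unfold costToGo
  split_ifs
  exacts [L_mono h _ _, le_rfl]

theorem bellman_mono (h : v ≤ w) : M.bellman ν v ≤ M.bellman ν w :=
  fun e => iInf_mono fun a => L_mono h e a

end Basic

section Bellman

set_option linter.unusedSectionVars false

variable {E A S : Type*} [TopologicalSpace E] [TopologicalSpace.MetrizableSpace E]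
  [SecondCountableTopology E] [MeasurableSpace E] [BorelSpace E]
  [TopologicalSpace A] [TopologicalSpace.MetrizableSpace A] [SecondCountableTopology A]
  [MeasurableSpace A] [BorelSpace A] [MeasurableSpace S] {M : Model E A S}
  {ν : Measure S} {g : ℝ → ℝ} {v : ExtState E → ℝ≥0∞}

theorem ContinuousCompact.measurable_c (hM : M.ContinuousCompact) : Measurable M.c :=
  hM.lsc_c.measurable

theorem ContinuousCompact.measurable_extT (hM : M.ContinuousCompact) {Y : Type*}
    [MeasurableSpace Y] {f : Y → ExtState E} {a : ∀ y, M.adm (f y).1} {z : Y → S}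
    (hf : Measurable f) (ha : Measurable fun y => (a y : A)) (hz : Measurable z) :
    Measurable fun y => M.extT (f y) (a y) (z y) := by
  have hp : Measurable fun y => (⟨((f y).1, a y), (a y).2⟩ : M.D) :=
    (hf.fst.prodMk ha).subtype_mk
  have hx : Measurable fun y => M.T (⟨((f y).1, a y), (a y).2⟩, z y) :=
    M.measurable_T.comp (hp.prodMk hz)
  have ht : Measurable fun y => ((f y).2.2 : ℝ≥0) := hf.snd.snd.subtype_val
  exact hx.prodMk ((hf.snd.fst.add (ht.mul (hM.measurable_c.comp (hp.prodMk hx)))).prodMk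
    (ht.const_mul M.β).subtype_mk)

/-- A set of state-action pairs that is closed relative to the admissible ones has a closed
projection; this is the upper semicontinuity of `x ↦ D(x)`. -/
theorem ContinuousCompact.isClosed_projection (hM : M.ContinuousCompact)
    {Γ : Set (ExtState E × A)} (hΓ : IsClosed Γ) :
    IsClosed {e : ExtState E | ∃ a ∈ M.adm e.1, (e, a) ∈ Γ} := by
  rw [← isSeqClosed_iff_isClosed]
  intro es e hes he
  choose as has hmem using hes
  obtain ⟨a, ha, hcl⟩ := hM.usc_adm (fun k => (es k).1) e.1 as
    ((continuous_fst.tendsto e).comp he) has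
  obtain ⟨φ, hφ, hlim⟩ := hcl.tendsto_subseq
  exact ⟨a, ha, hΓ.mem_of_tendsto ((he.comp hφ.tendsto_atTop).prodMk_nhds hlim)
    (Eventually.of_forall fun k => hmem (φ k))⟩

theorem ContinuousCompact.isClosed_adm_graph (hM : M.ContinuousCompact) :
    IsClosed {p : ExtState E × A | p.2 ∈ M.adm p.1.1} := by
  rw [← isSeqClosed_iff_isClosed]
  intro ps p hps hp
  obtain ⟨a, ha, hcl⟩ := hM.usc_adm (fun k => (ps k).1.1) p.1.1 (fun k => (ps k).2)
    (((continuous_fst.comp continuous_fst).tendsto p).comp hp) hps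
  obtain ⟨φ, hφ, hlim⟩ := hcl.tendsto_subseq
  have h := ((continuous_snd.tendsto p).comp hp).comp hφ.tendsto_atTop
  rwa [tendsto_nhds_unique hlim h] at ha

/-- The successor of a convergent sequence of state-action pairs may jump up in the cost
coordinate, but it dominates a sequence that converges to the successor of the limit and has the
same first coordinate. -/
theorem ContinuousCompact.exists_tendsto_extT (hM : M.ContinuousCompact) {es : ℕ → ExtState E}
    {e : ExtState E} {as : ∀ k, M.adm (es k).1} {a : M.adm e.1} (he : Tendsto es atTop (𝓝 e))
    (ha : Tendsto (fun k => (as k : A)) atTop (𝓝 a)) (z : S) :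
    ∃ r : ℕ → ExtState E, Tendsto r atTop (𝓝 (M.extT e a z)) ∧
      ∀ k, (r k).1 = (M.extT (es k) (as k) z).1 ∧ (r k).2 ≤ (M.extT (es k) (as k) z).2 := by
  let p : ℕ → M.D := fun k => ⟨((es k).1, as k), (as k).2⟩
  let p₀ : M.D := ⟨(e.1, a), a.2⟩
  have hp : Tendsto p atTop (𝓝 p₀) :=
    tendsto_subtype_rng.2 (((continuous_fst.tendsto e).comp he).prodMk_nhds ha)
  have hx : Tendsto (fun k => M.T (p k, z)) atTop (𝓝 (M.T (p₀, z))) :=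
    ((hM.continuous_T z).tendsto p₀).comp hp
  have ht : Tendsto (fun k => ((es k).2.2 : ℝ≥0)) atTop (𝓝 e.2.2) :=
    ((continuous_subtype_val.comp (continuous_snd.comp continuous_snd)).tendsto e).comp he
  have hs : Tendsto (fun k => (es k).2.1) atTop (𝓝 e.2.1) :=
    ((continuous_fst.comp continuous_snd).tendsto e).comp he
  -- Lower semicontinuity of the cost gives convergence of the truncated costs.
  have hc : Tendsto (fun k => min (M.c (p k, M.T (p k, z))) (M.c (p₀, M.T (p₀, z)))) atTop
      (𝓝 (M.c (p₀, M.T (p₀, z)))) := by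
    refine tendsto_order.2 ⟨fun l hl => ?_, fun u hu => ?_⟩
    · filter_upwards [(hp.prodMk_nhds hx).eventually (hM.lsc_c (p₀, M.T (p₀, z)) l hl)] with k hk
      exact lt_min hk hl
    · exact Eventually.of_forall fun k => (min_le_right _ _).trans_lt hu
  refine ⟨fun k => (M.T (p k, z), (es k).2.1 + (es k).2.2 *
    min (M.c (p k, M.T (p k, z))) (M.c (p₀, M.T (p₀, z))), (M.extT (es k) (as k) z).2.2),
    hx.prodMk_nhds ((hs.add (ht.mul hc)).prodMk_nhds
      (tendsto_subtype_rng.2 (ht.const_mul M.β))), fun k => ⟨rfl, ?_, le_rfl⟩⟩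
  exact add_le_add le_rfl (mul_le_mul_of_nonneg_left (min_le_left _ _) zero_le)

/-- Joint lower semicontinuity of `L v` in state and action: pointwise in the disturbance it
follows from the semicontinuity and monotonicity of `v`, and Fatou's lemma integrates it. -/
theorem ContinuousCompact.lowerSemicontinuous_costToGo (hM : M.ContinuousCompact)
    (hv : v ∈ potentialValues E g) :
    LowerSemicontinuous fun p : ExtState E × A => M.costToGo ν v p.1 p.2 := by
  rw [lowerSemicontinuous_iff_isClosed_preimage]
  intro y
  rcases eq_or_ne y ∞ with rfl | hy
  · simp
  rw [← isSeqClosed_iff_isClosed]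
  intro ps p hps hp
  have hadm : ∀ k, (ps k).2 ∈ M.adm (ps k).1.1 := by
    intro k
    by_contra h
    have := hps k
    simp [costToGo, h, hy] at this
  have hadm' : p.2 ∈ M.adm p.1.1 :=
    hM.isClosed_adm_graph.mem_of_tendsto hp (Eventually.of_forall hadm)
  have hle : ∀ k, M.L ν v (ps k).1 ⟨(ps k).2, hadm k⟩ ≤ y := by
    intro k
    have := hps k
    simpa [costToGo, hadm k] using this
  suffices M.L ν v p.1 ⟨p.2, hadm'⟩ ≤ y by simpa [costToGo, hadm'] using this
  have hmeas : ∀ k, Measurable fun z => v (M.extT (ps k).1 ⟨(ps k).2, hadm k⟩ z) := fun k =>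
    hv.1.measurable.comp (hM.measurable_extT measurable_const measurable_const measurable_id)
  calc M.L ν v p.1 ⟨p.2, hadm'⟩
      ≤ ∫⁻ z, liminf (fun k => v (M.extT (ps k).1 ⟨(ps k).2, hadm k⟩ z)) atTop ∂ν := by
        refine lintegral_mono fun z => ?_
        obtain ⟨r, hr, hrle⟩ := hM.exists_tendsto_extT (as := fun k => ⟨(ps k).2, hadm k⟩)
          (a := ⟨p.2, hadm'⟩) ((continuous_fst.tendsto p).comp hp)
          ((continuous_snd.tendsto p).comp hp) z
        refine le_of_forall_lt fun y hy => ?_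
        obtain ⟨y', hyy', hy'⟩ := exists_between hy
        refine hyy'.trans_le (le_liminf_of_le (by isBoundedDefault) ?_)
        filter_upwards [hr.eventually (hv.1 _ y' hy')] with k hk
        refine hk.le.trans ?_
        have h := hv.2.1 (r k).1 (hrle k).2
        have h' := (hrle k).1
        simp only at h
        rw [h'] at h
        convert h using 2
        exact Prod.ext h' rfl
    _ ≤ liminf (fun k => M.L ν v (ps k).1 ⟨(ps k).2, hadm k⟩) atTop := lintegral_liminf_le hmeas
    _ ≤ y := by
        refine liminf_le_of_le (by isBoundedDefault) fun b hb => ?_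
        obtain ⟨k, hk⟩ := hb.exists
        exact hk.trans (hle k)

theorem ContinuousCompact.isCompact_L_le (hM : M.ContinuousCompact)
    (hv : v ∈ potentialValues E g) (e : ExtState E) (r : ℝ≥0∞) :
    IsCompact {a | a ∈ M.adm e.1 ∧ M.costToGo ν v e a ≤ r} :=
  (hM.isCompact_adm e.1).inter_right (((hM.lowerSemicontinuous_costToGo hv).comp
    (Continuous.prodMk_right e)).isClosed_preimage r)

theorem ContinuousCompact.isClosed_costToGo_le (hM : M.ContinuousCompact)
    (hv : v ∈ potentialValues E g) {C : Set A} (hC : IsClosed C) (r : ℝ≥0∞) :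
    IsClosed {e : ExtState E | ∃ a ∈ M.adm e.1 ∩ C, M.costToGo ν v e a ≤ r} := by
  convert hM.isClosed_projection ((hC.preimage continuous_snd).inter
    ((hM.lowerSemicontinuous_costToGo (ν := ν) hv).isClosed_preimage r)) using 3 with e
  simp [and_assoc]

theorem ContinuousCompact.isCompactCorrespondence (hM : M.ContinuousCompact) :
    IsCompactCorrespondence fun e : ExtState E => M.adm e.1 where
  nonempty e := let ⟨f, hf⟩ := M.exists_selector; ⟨f e.1, hf.2 e.1⟩
  isCompact e := hM.isCompact_adm e.1
  measurableSet_hit _ hC := (hM.isClosed_projection (hC.preimage continuous_snd)).measurableSet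

/-- The infimum in the Bellman operator is attained by a measurable decision rule. -/
theorem ContinuousCompact.exists_ruleOp_eq_bellman [StandardBorelSpace A]
    (hM : M.ContinuousCompact) (hv : v ∈ potentialValues E g) :
    ∃ d : M.Rule, M.ruleOp ν d v = M.bellman ν v := by
  obtain ⟨f, hf, hmem⟩ := (hM.isCompactCorrespondence.argmin (u := M.costToGo ν v)
    (fun e => (hM.lowerSemicontinuous_costToGo hv).comp (Continuous.prodMk_right e))
    fun C hC q => (hM.isClosed_costToGo_le hv hC q).measurableSet).exists_measurable_selector
  refine ⟨⟨f, hf, fun e => (hmem e).1⟩, funext fun e => le_antisymm (le_iInf fun a => ?_)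
    (iInf_le _ _)⟩
  have h := (hmem e).2 a a.2
  rwa [costToGo_coe e a, costToGo_coe e ⟨f e, (hmem e).1⟩] at h

theorem monotone_L_snd (hv : v ∈ potentialValues E g) {x : E} {st st' : ℝ≥0 × PosReal}
    (h : st ≤ st') (a : M.adm x) : M.L ν v (x, st) a ≤ M.L ν v (x, st') a := by
  refine lintegral_mono fun z => hv.2.1 _ (Prod.mk_le_mk.2 ⟨?_, ?_⟩)
  · exact add_le_add h.1 (mul_le_mul_of_nonneg_right h.2 zero_le)
  · exact Subtype.mk_le_mk.2 (mul_le_mul_of_nonneg_left h.2 zero_le)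

/-- The set of potential value functions is invariant under the Bellman operator. -/
theorem ContinuousCompact.bellman_mem [StandardBorelSpace A] [IsProbabilityMeasure ν]
    (hM : M.ContinuousCompact) (hg : IsDisutility g) (hv : v ∈ potentialValues E g) :
    M.bellman ν v ∈ potentialValues E g := by
  refine ⟨?_, fun x st st' h => iInf_mono fun a => monotone_L_snd hv h a,
    fun e => le_iInf fun a => ?_⟩
  · obtain ⟨d, hd⟩ := hM.exists_ruleOp_eq_bellman (ν := ν) hv
    rw [lowerSemicontinuous_iff_isClosed_preimage]
    intro r
    convert hM.isClosed_costToGo_le (ν := ν) hv isClosed_univ r using 1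
    ext e
    constructor
    · intro h
      refine ⟨d.act e, ⟨(d.act e).2, trivial⟩, ?_⟩
      rw [costToGo_coe]
      exact (congrFun hd e).trans_le h
    · rintro ⟨a, ha, h⟩
      rw [costToGo_coe e ⟨a, ha.1⟩] at h
      exact (iInf_le _ (⟨a, ha.1⟩ : M.adm e.1)).trans h
  · calc ENNReal.ofReal (g e.2.1) = ∫⁻ _, ENNReal.ofReal (g e.2.1) ∂ν := by simp
      _ ≤ M.L ν v e a := lintegral_mono fun z => (ENNReal.ofReal_le_ofReal (hg.mono
          (NNReal.coe_le_coe.2 le_self_add))).trans (hv.2.2 (M.extT e a z))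

/-- The Bellman operator commutes with increasing limits, by compactness of the sets of admissible
actions. -/
theorem ContinuousCompact.bellman_iSup (hM : M.ContinuousCompact) {V : ℕ → ExtState E → ℝ≥0∞}
    (hV : ∀ n, V n ∈ potentialValues E g) (hmono : Monotone V) :
    M.bellman ν (⨆ n, V n) = ⨆ n, M.bellman ν (V n) := by
  refine le_antisymm (fun e => ?_) (iSup_le fun n => bellman_mono (le_iSup V n))
  set r := (⨆ n, M.bellman ν (V n)) e with hr
  have hmin : ∀ n, ∃ a ∈ M.adm e.1, M.costToGo ν (V n) e a ≤ r := by
    intro n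
    obtain ⟨a, ha, hmin⟩ := (((hM.lowerSemicontinuous_costToGo (ν := ν) (hV n)).comp
      (Continuous.prodMk_right e)).lowerSemicontinuousOn (M.adm e.1)).exists_isMinOn
      (hM.isCompactCorrespondence.nonempty e) (hM.isCompact_adm e.1)
    refine ⟨a, ha, le_trans (le_iInf fun b => ?_) (le_iSup (fun n => M.bellman ν (V n)) n e)⟩
    rw [← costToGo_coe]
    exact hmin b.2
  have hcomp := fun n => hM.isCompact_L_le (ν := ν) (hV n) e r
  obtain ⟨a, ha⟩ := IsCompact.nonempty_iInter_of_sequence_nonempty_isCompact_isClosed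
    (fun n => {a | a ∈ M.adm e.1 ∧ M.costToGo ν (V n) e a ≤ r})
    (fun n a ha => ⟨ha.1, (costToGo_mono (hmono n.le_succ) e a).trans ha.2⟩)
    hmin (hcomp 0) (fun n => (hcomp n).isClosed)
  rw [Set.mem_iInter] at ha
  refine (iInf_le _ ⟨a, (ha 0).1⟩).trans ?_
  calc M.L ν (⨆ n, V n) e ⟨a, (ha 0).1⟩ = ⨆ n, M.L ν (V n) e ⟨a, (ha 0).1⟩ := by
        simp only [L, iSup_apply]
        exact lintegral_iSup (fun n => (hV n).1.measurable.comp (hM.measurable_extT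
          measurable_const measurable_const measurable_id)) fun m n h z => hmono h _
    _ ≤ r := iSup_le fun n => by
        rw [← costToGo_coe]
        exact (ha n).2

end Bellman

end Model

/-! ### The extended disutility function -/

section Disutility

variable {g : ℝ → ℝ}

theorem IsDisutility.continuous (hg : IsDisutility g) : Continuous g := by
  simpa [continuousOn_univ] using hg.convex.continuousOn isOpen_univ

/-- Continuity of the extended disutility along increasing sequences, including those that
tend to `∞`. -/
theorem IsDisutility.iSup_ofReal_eq_gExt (hg : IsDisutility g) {y : ℕ → ℝ≥0} (hy : Monotone y) :
    ⨆ n, ENNReal.ofReal (g (y n)) = gExt g (⨆ n, (y n : ℝ≥0∞)) := by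
  have hmono : Monotone fun r : ℝ≥0 => ENNReal.ofReal (g r) := fun r s h =>
    ENNReal.ofReal_le_ofReal (hg.mono (NNReal.coe_le_coe.2 h))
  by_cases htop : ⨆ n, (y n : ℝ≥0∞) = ∞
  · rw [gExt, if_pos htop]
    refine le_antisymm (iSup_le fun n => le_iSup (fun r : ℝ≥0 => ENNReal.ofReal (g r)) (y n))
      (iSup_le fun r => ?_)
    obtain ⟨n, hn⟩ := lt_iSup_iff.1 (htop ▸ ENNReal.coe_lt_top : (r : ℝ≥0∞) < ⨆ n, (y n : ℝ≥0∞))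
    exact (hmono (ENNReal.coe_lt_coe.1 hn).le).trans
      (le_iSup (fun n => ENNReal.ofReal (g (y n))) n)
  · rw [gExt, if_neg htop]
    refine iSup_eq_of_tendsto (fun m n h => hmono (hy h)) ?_
    refine (ENNReal.continuous_ofReal.tendsto _).comp ((hg.continuous.tendsto _).comp ?_)
    exact (ENNReal.tendsto_toReal htop).comp
      (tendsto_atTop_iSup fun m n h => ENNReal.coe_le_coe.2 (hy h))

/-- The value function `(x, s, t) ↦ g(s)` of the empty horizon, the least element of `𝕄`. -/
def terminalValue (E : Type*) (g : ℝ → ℝ) (e : ExtState E) : ℝ≥0∞ := ENNReal.ofReal (g (e.2.1 : ℝ))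

theorem IsDisutility.terminalValue_mem {E : Type*} [TopologicalSpace E] (hg : IsDisutility g) :
    terminalValue E g ∈ potentialValues E g := by
  refine ⟨Continuous.lowerSemicontinuous ?_, fun x st st' h => ?_, fun e => le_rfl⟩
  · exact ENNReal.continuous_ofReal.comp (hg.continuous.comp
      (NNReal.continuous_coe.comp (continuous_fst.comp continuous_snd)))
  · exact ENNReal.ofReal_le_ofReal (hg.mono (NNReal.coe_le_coe.2 h.1))

theorem iSup_mem_potentialValues {E : Type*} [TopologicalSpace E] {V : ℕ → ExtState E → ℝ≥0∞}
    (hV : ∀ n, V n ∈ potentialValues E g) : (⨆ n, V n) ∈ potentialValues E g := by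
  have hsup : (⨆ n, V n) = fun e => ⨆ n, V n e := funext fun e => iSup_apply
  rw [hsup]
  refine ⟨lowerSemicontinuous_iSup fun n => (hV n).1, fun x st st' h => ?_, fun e => ?_⟩
  · exact iSup_mono fun n => (hV n).2.1 x h
  · exact ((hV 0).2.2 e).trans (le_iSup (fun n => V n e) 0)

end Disutility

namespace Model

/-! ### The extended decision process -/

section Trajectory

variable {E A S Ω : Type*} [MeasurableSpace E] [MeasurableSpace A] [MeasurableSpace S]
  {M : Model E A S} {Z : ℕ → Ω → S} {π : M.Policy} {e : ExtState E}

theorem process_snd_snd (n : ℕ) (ω : Ω) :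
    ((M.process Z π e ω n).2.2 : ℝ≥0) = M.β ^ n * e.2.2 := by
  induction n with
  | zero => simp [process]
  | succ n ih =>
    rw [pow_succ', mul_assoc, ← ih]
    rfl

theorem process_snd_fst (n : ℕ) (ω : Ω) : (M.process Z π e ω n).2.1 =
    e.2.1 + e.2.2.1 * ∑ k ∈ Finset.range n, M.β ^ k * M.stageCost Z π e k ω := by
  induction n with
  | zero => simp [process]
  | succ n ih =>
    have h : (M.process Z π e ω (n + 1)).2.1 = (M.process Z π e ω n).2.1 +
      (M.process Z π e ω n).2.2 * M.stageCost Z π e n ω := rfl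
    rw [h, ih, process_snd_snd, Finset.sum_range_succ]
    ring

variable [MeasurableSpace Ω] {P : Measure Ω} {g : ℝ → ℝ}

theorem policyValue_eq_lintegral_terminalValue (N : ℕ) :
    M.policyValue P Z g N π e = ∫⁻ ω, terminalValue E g (M.process Z π e ω N) ∂P := by
  simp only [policyValue, terminalValue, process_snd_fst]

theorem policyValue_mono_horizon (hg : IsDisutility g) :
    Monotone fun N => M.policyValue P Z g N π e := fun m n h =>
  lintegral_mono fun ω => ENNReal.ofReal_le_ofReal (hg.mono (NNReal.coe_le_coe.2 (by gcongr)))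

end Trajectory

section Dynamics

set_option linter.unusedSectionVars false

variable {E A S Ω : Type*} [TopologicalSpace E] [TopologicalSpace.MetrizableSpace E]
  [SecondCountableTopology E] [MeasurableSpace E] [BorelSpace E]
  [TopologicalSpace A] [TopologicalSpace.MetrizableSpace A] [SecondCountableTopology A]
  [MeasurableSpace A] [BorelSpace A] [MeasurableSpace S] {M : Model E A S}
  {Z : ℕ → Ω → S} {π : M.Policy} {e : ExtState E} {g : ℝ → ℝ} {v : ExtState E → ℝ≥0∞}

/-- The state at time `n` is measurable with respect to the first `n` disturbances. -/
theorem ContinuousCompact.measurable_process (hM : M.ContinuousCompact) {mΩ : MeasurableSpace Ω}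
    {n : ℕ} (hZ : ∀ i < n, Measurable (Z i)) : Measurable fun ω => M.process Z π e ω n := by
  induction n with
  | zero => exact measurable_const
  | succ n ih =>
    have h := ih fun i hi => hZ i (hi.trans n.lt_succ_self)
    exact hM.measurable_extT (a := fun ω => (π n).act (M.process Z π e ω n)) h
      ((π n).measurable_toFun.comp h) (hZ n n.lt_succ_self)

variable [MeasurableSpace Ω] {P : Measure Ω} [IsProbabilityMeasure P] {ν : Measure S}

theorem ContinuousCompact.indepFun_process (hM : M.ContinuousCompact)
    (hZ : ∀ n, Measurable (Z n)) (hind : iIndepFun Z P) (n : ℕ) :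
    IndepFun (fun ω => M.process Z π e ω n) (Z n) P := by
  have h := indep_iSup_of_disjoint (fun i => (hZ i).comap_le) hind.iIndep
    (S := Set.Iio n) (T := {n}) (by simp)
  refine indep_of_indep_of_le_right (indep_of_indep_of_le_left h ?_) (by simp)
  refine Measurable.comap_le (hM.measurable_process
    (mΩ := ⨆ i ∈ Set.Iio n, MeasurableSpace.comap (Z i) inferInstance) fun i hi => ?_)
  exact (comap_measurable (Z i)).mono (le_biSup (fun i => MeasurableSpace.comap (Z i) _) hi) le_rfl

/-- One step of the dynamics in expectation: the current state is independent of the next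
disturbance, which may therefore be integrated out first. -/
theorem ContinuousCompact.lintegral_process_succ (hM : M.ContinuousCompact)
    (hZ : ∀ n, Measurable (Z n)) (hind : iIndepFun Z P) (hν : ∀ n, P.map (Z n) = ν)
    (hv : Measurable v) (n : ℕ) :
    ∫⁻ ω, v (M.process Z π e ω (n + 1)) ∂P
      = ∫⁻ ω, M.ruleOp ν (π n) v (M.process Z π e ω n) ∂P := by
  have hX : Measurable fun ω => M.process Z π e ω n := hM.measurable_process fun i _ => hZ i
  have : IsProbabilityMeasure ν := hν n ▸ Measure.isProbabilityMeasure_map (hZ n).aemeasurable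
  have hstep : Measurable fun p : ExtState E × S => v (M.extT p.1 ((π n).act p.1) p.2) :=
    hv.comp (hM.measurable_extT (a := fun p : ExtState E × S => (π n).act p.1) measurable_fst
      ((π n).measurable_toFun.comp measurable_fst) measurable_snd)
  have hlaw := (hM.indepFun_process (π := π) (e := e) hZ hind n).map_prod_eq_prod_map_map
    hX.aemeasurable (hZ n).aemeasurable
  rw [hν n] at hlaw
  calc ∫⁻ ω, v (M.process Z π e ω (n + 1)) ∂P
      = ∫⁻ p, v (M.extT p.1 ((π n).act p.1) p.2) ∂(P.map fun ω => (M.process Z π e ω n, Z n ω)) :=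
        (lintegral_map hstep (hX.prodMk (hZ n))).symm
    _ = ∫⁻ x, ∫⁻ z, v (M.extT x ((π n).act x) z) ∂ν ∂(P.map fun ω => M.process Z π e ω n) := by
        rw [hlaw, lintegral_prod _ hstep.aemeasurable]
    _ = ∫⁻ ω, M.ruleOp ν (π n) v (M.process Z π e ω n) ∂P :=
        lintegral_map hstep.lintegral_prod_right' hX

theorem ContinuousCompact.policyValueInf_eq_iSup (hM : M.ContinuousCompact)
    (hg : IsDisutility g) (hZ : ∀ n, Measurable (Z n)) :
    M.policyValueInf P Z g π e = ⨆ N, M.policyValue P Z g N π e := by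
  simp only [policyValue_eq_lintegral_terminalValue]
  have hsum : ∀ ω, Monotone fun N => (M.process Z π e ω N).2.1 := by
    intro ω m n h
    simp only [process_snd_fst]
    gcongr
  rw [← lintegral_iSup (f := fun N ω => terminalValue E g (M.process Z π e ω N))
    (fun N => hg.terminalValue_mem.1.measurable.comp (hM.measurable_process fun i _ => hZ i))
    fun m n h ω => ENNReal.ofReal_le_ofReal (hg.mono (NNReal.coe_le_coe.2 (hsum ω h)))]
  refine lintegral_congr fun ω => ?_
  simp only [terminalValue]
  rw [hg.iSup_ofReal_eq_gExt (hsum ω), ENNReal.tsum_eq_iSup_nat, ENNReal.mul_iSup,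
    ENNReal.add_iSup]
  simp only [process_snd_fst]
  push_cast
  rfl

end Dynamics

/-! ### Value iteration and optimality -/

section Optimality

set_option linter.unusedSectionVars false

variable {E A S Ω : Type*} [TopologicalSpace E] [TopologicalSpace.MetrizableSpace E]
  [SecondCountableTopology E] [MeasurableSpace E] [BorelSpace E]
  [TopologicalSpace A] [TopologicalSpace.MetrizableSpace A] [SecondCountableTopology A]
  [MeasurableSpace A] [BorelSpace A] [StandardBorelSpace A] [MeasurableSpace S] {M : Model E A S}
  {Z : ℕ → Ω → S} {π : M.Policy} {e : ExtState E} {g : ℝ → ℝ} {v : ExtState E → ℝ≥0∞}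
  [MeasurableSpace Ω] {P : Measure Ω} [IsProbabilityMeasure P] {ν : Measure S}

/-- The `n`-th iterate of the Bellman operator on the terminal value function. -/
noncomputable def valueIter (M : Model E A S) (ν : Measure S) (g : ℝ → ℝ) (n : ℕ) :
    ExtState E → ℝ≥0∞ :=
  (M.bellman ν)^[n] (terminalValue E g)

theorem valueIter_succ (n : ℕ) :
    M.valueIter ν g (n + 1) = M.bellman ν (M.valueIter ν g n) :=
  Function.iterate_succ_apply' ..

theorem ContinuousCompact.valueIter_mem [IsProbabilityMeasure ν] (hM : M.ContinuousCompact)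
    (hg : IsDisutility g) (n : ℕ) : M.valueIter ν g n ∈ potentialValues E g := by
  induction n with
  | zero => exact hg.terminalValue_mem
  | succ n ih =>
    rw [valueIter_succ]
    exact hM.bellman_mem hg ih

theorem ContinuousCompact.monotone_valueIter [IsProbabilityMeasure ν] (hM : M.ContinuousCompact)
    (hg : IsDisutility g) : Monotone (M.valueIter ν g) := by
  refine monotone_nat_of_le_succ fun n => ?_
  induction n with
  | zero => exact (hM.valueIter_mem hg 1).2.2
  | succ n ih =>
    rw [valueIter_succ, valueIter_succ (n + 1)]
    exact bellman_mono ih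

theorem valueIter_le_of_bellman_eq (hv : v ∈ potentialValues E g) (hfix : M.bellman ν v = v)
    (n : ℕ) : M.valueIter ν g n ≤ v := by
  induction n with
  | zero => exact hv.2.2
  | succ n ih =>
    rw [valueIter_succ, ← hfix]
    exact bellman_mono ih

/-- Under any policy, `k` stages of play cost in expectation at least what `k` applications of the
Bellman operator give, because each stage applies some `𝒯_d ≥ 𝒯`. -/
theorem ContinuousCompact.valueIter_le_lintegral_process [IsProbabilityMeasure ν]
    (hM : M.ContinuousCompact) (hg : IsDisutility g) (hZ : ∀ n, Measurable (Z n))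
    (hind : iIndepFun Z P) (hν : ∀ n, P.map (Z n) = ν) (k m : ℕ) :
    M.valueIter ν g (m + k) e ≤ ∫⁻ ω, M.valueIter ν g m (M.process Z π e ω k) ∂P := by
  induction k generalizing m with
  | zero => simp [process]
  | succ k ih =>
    rw [hM.lintegral_process_succ hZ hind hν (hM.valueIter_mem hg m).1.measurable,
      show m + (k + 1) = m + 1 + k by omega]
    refine (ih (m + 1)).trans (lintegral_mono fun ω => ?_)
    rw [valueIter_succ]
    exact iInf_le _ _

/-- The value iteration theorem for a finite horizon. -/
theorem ContinuousCompact.value_eq_valueIter [IsProbabilityMeasure ν] (hM : M.ContinuousCompact)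
    (hg : IsDisutility g) (hZ : ∀ n, Measurable (Z n)) (hind : iIndepFun Z P)
    (hν : ∀ n, P.map (Z n) = ν) (N : ℕ) : M.value P Z g N = M.valueIter ν g N := by
  refine funext fun e => le_antisymm ?_ (le_iInf fun π => ?_)
  · choose d hd using fun n => hM.exists_ruleOp_eq_bellman (ν := ν)
      (hM.valueIter_mem (ν := ν) hg n)
    -- With `N - k` stages to go, the policy minimizes against the value of `N - k - 1` stages.
    let π : M.Policy := fun k => d (N - 1 - k)
    have h : ∀ k ≤ N, ∫⁻ ω, M.valueIter ν g (N - k) (M.process Z π e ω k) ∂P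
        = M.valueIter ν g N e := by
      intro k
      induction k with
      | zero => simp [process]
      | succ k ih =>
        intro hk
        rw [hM.lintegral_process_succ hZ hind hν (hM.valueIter_mem hg _).1.measurable,
          ← ih (by omega), show N - k = N - (k + 1) + 1 by omega, valueIter_succ, ← hd]
        simp only [π, show N - 1 - k = N - (k + 1) by omega]
    refine (iInf_le _ π).trans_eq ?_
    rw [policyValue_eq_lintegral_terminalValue, ← h N le_rfl, Nat.sub_self]
    rfl
  · rw [policyValue_eq_lintegral_terminalValue]
    have h := hM.valueIter_le_lintegral_process (π := π) (e := e) hg hZ hind hν N 0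
    rwa [Nat.zero_add] at h

/-- If a decision rule attains the infimum in the Bellman equation, then the solution of that
equation dominates the infinite-horizon cost of the corresponding stationary policy. -/
theorem ContinuousCompact.policyValueInf_stationary_le (hM : M.ContinuousCompact)
    (hg : IsDisutility g) (hZ : ∀ n, Measurable (Z n)) (hind : iIndepFun Z P)
    (hν : ∀ n, P.map (Z n) = ν) (hv : v ∈ potentialValues E g) {d : M.Rule}
    (hd : M.ruleOp ν d v = v) : M.policyValueInf P Z g (fun _ => d) ≤ v := by
  intro e
  rw [hM.policyValueInf_eq_iSup hg hZ]
  refine iSup_le fun N => ?_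
  have h : ∀ k, ∫⁻ ω, v (M.process Z (fun _ => d) e ω k) ∂P = v e := by
    intro k
    induction k with
    | zero => simp [process]
    | succ k ih => rw [hM.lintegral_process_succ hZ hind hν hv.1.measurable, hd, ih]
  rw [policyValue_eq_lintegral_terminalValue, ← h N]
  exact lintegral_mono fun ω => hv.2.2 _

end Optimality

end Model

end SpectralMDP

theorem theorem5p1
    {E A S Ω : Type*}
    [TopologicalSpace E] [TopologicalSpace.MetrizableSpace E] [SecondCountableTopology E]
    [MeasurableSpace E] [BorelSpace E] [StandardBorelSpace E]
    [TopologicalSpace A] [TopologicalSpace.MetrizableSpace A] [SecondCountableTopology A]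
    [MeasurableSpace A] [BorelSpace A] [StandardBorelSpace A]
    [MeasurableSpace S]
    [MeasurableSpace Ω] (P : Measure Ω) [IsProbabilityMeasure P]
    (M : SpectralMDP.Model E A S) (hM : M.ContinuousCompact)
    (g : ℝ → ℝ) (hg : SpectralMDP.IsDisutility g)
    (Z : ℕ → Ω → S) (hZ : ∀ n, Measurable (Z n)) (hind : iIndepFun Z P)
    (ν : Measure S) (hν : ∀ n, P.map (Z n) = ν) :
    (∀ e : SpectralMDP.ExtState E,
      Tendsto (fun N : ℕ => M.value P Z g N e) atTop (𝓝 (M.valueInf P Z g e))) ∧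
    IsLeast {v | v ∈ SpectralMDP.potentialValues E g ∧ M.bellman ν v = v} (M.valueInf P Z g) ∧
    (∃ d : M.Rule, M.ruleOp ν d (M.valueInf P Z g) = M.bellman ν (M.valueInf P Z g)) ∧
    ∀ d : M.Rule, M.ruleOp ν d (M.valueInf P Z g) = M.bellman ν (M.valueInf P Z g) →
      M.policyValueInf P Z g (fun _ => d) = M.valueInf P Z g := by
  have : IsProbabilityMeasure ν := hν 0 ▸ Measure.isProbabilityMeasure_map (hZ 0).aemeasurable
  have hmono : Monotone (M.valueIter ν g) := hM.monotone_valueIter hg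
  have hmem : (⨆ N, M.valueIter ν g N) ∈ SpectralMDP.potentialValues E g :=
    SpectralMDP.iSup_mem_potentialValues (hM.valueIter_mem hg)
  have hfix : M.bellman ν (⨆ N, M.valueIter ν g N) = ⨆ N, M.valueIter ν g N := by
    rw [hM.bellman_iSup (hM.valueIter_mem hg) hmono]
    simp only [← SpectralMDP.Model.valueIter_succ]
    exact hmono.iSup_nat_add 1
  obtain ⟨d, hd⟩ := hM.exists_ruleOp_eq_bellman (ν := ν) hmem
  have hval : M.valueInf P Z g = ⨆ N, M.valueIter ν g N := by
    refine le_antisymm (fun e => (iInf_le _ fun _ => d).trans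
      (hM.policyValueInf_stationary_le hg hZ hind hν hmem (hd.trans hfix) e))
      (iSup_le fun N e => le_iInf fun π => ?_)
    rw [hM.policyValueInf_eq_iSup hg hZ, ← hM.value_eq_valueIter hg hZ hind hν N]
    exact (iInf_le _ π).trans (le_iSup (fun N => M.policyValue P Z g N π e) N)
  refine ⟨fun e => ?_, ?_, ?_, fun d' hd' => ?_⟩
  · simp only [hM.value_eq_valueIter hg hZ hind hν, hval, iSup_apply]
    exact tendsto_atTop_iSup fun m n h => hmono h e
  · rw [hval]
    exact ⟨⟨hmem, hfix⟩, fun v hv =>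
      iSup_le fun N => SpectralMDP.Model.valueIter_le_of_bellman_eq hv.1 hv.2 N⟩
  · rw [hval]
    exact ⟨d, hd⟩
  · rw [hval, hfix] at hd'
    refine le_antisymm ?_ fun e => iInf_le _ _
    rw [hval]
    exact hM.policyValueInf_stationary_le hg hZ hind hν hmem hd'
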